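/- Hard-core model and mixing. Let $G=(V,E)$ be a finite or infinite graph and $\lambda>0$. A boundary condition $\tau$ on $S\subseteq V$ prescribes which vertices of $S$ are occupied, no two adjacent vertices being occupied. If $V\setminus S$ is finite, the hard-core model at activity $\lambda$ conditional on $\tau$ is the distribution on the independent sets of $G$ that agree with $\tau$ on $S$, in which a configuration with $k$ occupied vertices in $V\setminus S$ has probability proportional to $\lambda^k$; let $p_v(\tau)$ be the probability that $v$ is unoccupied. WSM holds for $G$ at $\lambda$ if there is $0<\gamma<1$ such that $|p_v(\tau_1)-p_v(\tau_2)|\le\gamma^{\mathrm{dist}(v,S)}$ for every $v\in V$, every $S\subseteq V$ with $V\setminus S$ finite, and all boundary conditions $\tau_1,\tau_2$ on $S$. SSM holds for $G$ at $\lambda$ if there is $0<\gamma<1$ such that $|p_v(\tau_1)-p_v(\tau_2)|\le\gamma^{\mathrm{dist}(v,S')}$ for every $v\in V$, every such $S$, every $S'\subseteq S$, and all boundary conditions $\tau_1,\tau_2$ on $S$ that agree on $S\setminus S'$. Here $\mathrm{dist}$ is the graph distance, with $\mathrm{dist}(v,S')=\infty$ and $\gamma^\infty=0$ if $S'$ cannot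 be reached from $v$. Weitz's tree. Consider $\mathbb{Z}^2$ with its nearest-neighbor edges. A neighbor ordering $\sigma=(\sigma_w)_{w\in\mathbb{Z}^2}$ consists of a linear ordering $\sigma_w$ of the four neighbors of each vertex $w$; it is homogeneous if it orders the four directions in the same way at every vertex. For $v\in\mathbb{Z}^2$ consider the tree, rooted at the trivial walk, whose vertices are the self-avoiding walks from $v$ together with, as leaves, the walks $v\to\dots\to w\to v_1\to\dots\to v_\ell\to w$ that are self-avoiding up to the last step, which closes a cycle (so $v_1\ne v_\ell$); the parent of a walk is obtained by deleting its last step. Such a leaf is fixed to be unoccupied if $v_1>v_\ell$ in $\sigma_w$, and occupied if $v_1<v_\ell$ in $\sigma_w$. The tree $T_{\mathrm{saw}}^\sigma(\mathbb{Z}^2,v)$ is obtained by removing every unoccupied leaf and, for every occupied leaf, the whole subtree rooted at its parent. Theorem. Let $\sigma$ be any neighbor ordering of $\mathbb{Z}^2$ and $v\in\mathbb{Z}^2$. Then, for every $\lambda>3.4$, SSM does not hold on $T_{\mathrm{saw}}^\sigma(\mathbb{Z}^2,v)$; moreover, $T_{\mathrm{saw}}^\sigma(\mathbb{Z}^2,v)$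 has a subtree (a connected induced subgraph) on which WSM does not hold for any $\lambda>3.4$. If $\sigma$ is homogeneous, the same two assertions hold with $3.4$ replaced by $3$. -/

import Mathlib

section HardCore

variable {V : Type*}

/-- The graph distance from `v` to (the nearest point of) the set `S`; it is `⊤` if no point of
`S` can be reached from `v`, in particular if `S` is empty. -/
noncomputable def distToSet (G : SimpleGraph V) (v : V) (S : Set V) : ℕ∞ :=
  ⨅ s ∈ S, G.edist v s

/-- `A` is (the set of occupied vertices of) a feasible boundary condition on `S`. -/
def IsBoundaryCondition (G : SimpleGraph V) (S A : Set V) : Prop :=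
  A ⊆ S ∧ G.IsIndepSet A

open Classical in
/-- The total weight of the hard-core configurations at activity `lam` that agree with the boundary
condition `A` outside the finite region `R` and satisfy `P`. A configuration is given by its set
`I` of occupied vertices in `R`, and `I ∪ A` has to be an independent set of `G`. -/
noncomputable def hardCoreWeight (G : SimpleGraph V) (lam : ℝ) (R : Finset V) (A : Set V)
    (P : Set V → Prop) : ℝ :=
  ∑ I ∈ R.powerset.filter
      (fun I : Finset V => G.IsIndepSet ((I : Set V) ∪ A) ∧ P ((I : Set V) ∪ A)),
    lam ^ I.card

/-- The probability that `v` is unoccupied in the hard-core Gibbs distribution at activity `lam`,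
conditional on the boundary condition `A` outside the finite region `R`. -/
noncomputable def unoccupiedProb (G : SimpleGraph V) (lam : ℝ) (R : Finset V) (A : Set V)
    (v : V) : ℝ :=
  hardCoreWeight G lam R A (fun J => v ∉ J) / hardCoreWeight G lam R A (fun _ => True)

/-- Weak spatial mixing of the hard-core model on `G` at activity `lam`. The boundary set is
`S = Rᶜ`, where `R` runs over the finite sets of vertices, so that on an infinite graph the
conditional Gibbs distribution is well defined; on a finite graph every `S` is of this form.
The bound by `γ ^ dist(v, S)`, which is `0` at infinite distance, is written as the bound by
`γ ^ n` for all natural numbers `n ≤ dist(v, S)`. -/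
def WSM (G : SimpleGraph V) (lam : ℝ) : Prop :=
  ∃ γ : ℝ, 0 < γ ∧ γ < 1 ∧
    ∀ (v : V) (R : Finset V) (A₁ A₂ : Set V),
      IsBoundaryCondition G (R : Set V)ᶜ A₁ → IsBoundaryCondition G (R : Set V)ᶜ A₂ →
      ∀ n : ℕ, (n : ℕ∞) ≤ distToSet G v (R : Set V)ᶜ →
        |unoccupiedProb G lam R A₁ v - unoccupiedProb G lam R A₂ v| ≤ γ ^ n

/-- Strong spatial mixing of the hard-core model on `G` at activity `lam`: the two boundary
conditions on `S = Rᶜ` agree on `S \ S'`, and the decay is in the distance to `S'`. -/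
def SSM (G : SimpleGraph V) (lam : ℝ) : Prop :=
  ∃ γ : ℝ, 0 < γ ∧ γ < 1 ∧
    ∀ (v : V) (R : Finset V) (S' A₁ A₂ : Set V), S' ⊆ (R : Set V)ᶜ →
      IsBoundaryCondition G (R : Set V)ᶜ A₁ → IsBoundaryCondition G (R : Set V)ᶜ A₂ →
      (∀ u ∈ (R : Set V)ᶜ \ S', u ∈ A₁ ↔ u ∈ A₂) →
      ∀ n : ℕ, (n : ℕ∞) ≤ distToSet G v S' →
        |unoccupiedProb G lam R A₁ v - unoccupiedProb G lam R A₂ v| ≤ γ ^ n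

end HardCore

section SawTree

variable {V : Type*}

/-- A walk `v₀ → v₁ → ⋯ → vₛ` is recorded as the list `[vₛ, …, v₁, v₀]`, so that its one-step
extensions are the lists `w :: l` and its initial segments are the suffixes of the list.
`IsSAW G v l` says that `l` is a self-avoiding walk of `G` that starts at `v`. -/
def IsSAW (G : SimpleGraph V) (v : V) (l : List V) : Prop :=
  l.getLast? = some v ∧ l.IsChain G.Adj ∧ l.Nodup

/-- `l` is a walk `v → ⋯ → w → x → ⋯ → y → w` that starts at `v`, is self-avoiding up to its last
step, and whose last step closes the cycle `w → x → ⋯ → y → w` (of length at least three). -/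
def ClosesCycle (G : SimpleGraph V) (v : V) (l : List V) (w x y : V) : Prop :=
  ∃ q b : List V, l = w :: y :: (q ++ x :: w :: b) ∧
    IsSAW G v (y :: (q ++ x :: w :: b)) ∧ G.Adj y w

/-- The vertices of the tree of self-avoiding walks from `v`: the self-avoiding walks, and, as
leaves, the walks that have just closed a cycle. The edges of the tree are those of `walkGraph`. -/
def sawVertices (G : SimpleGraph V) (v : V) : Set (List V) :=
  {l | IsSAW G v l ∨ ∃ w x y, ClosesCycle G v l w x y}

/-- Two walks are adjacent if one of them extends the other by one step. -/
def walkGraph (V : Type*) : SimpleGraph (List V) where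
  Adj l l' := (∃ w, l' = w :: l) ∨ (∃ w, l = w :: l')
  symm := ⟨fun _ _ h => h.symm⟩
  loopless := ⟨fun l h => by
    rcases h with ⟨w, h⟩ | ⟨w, h⟩ <;> exact absurd (congrArg List.length h) (by simp)⟩

/-- A neighbor ordering: a linear ordering of the neighbors of each vertex. -/
abbrev NeighborOrdering (G : SimpleGraph V) : Type _ :=
  ∀ w : V, LinearOrder (G.neighborSet w)

/-- `x` and `y` are neighbors of `w`, and `x` precedes `y` in the ordering `σ w`. -/
def NeighborOrdering.Precedes {G : SimpleGraph V} (σ : NeighborOrdering G) (w x y : V) : Prop :=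
  ∃ (hx : x ∈ G.neighborSet w) (hy : y ∈ G.neighborSet w), (σ w).lt ⟨x, hx⟩ ⟨y, hy⟩

/-- A leaf `v → ⋯ → w → x → ⋯ → y → w` of the self-avoiding walk tree is fixed to be occupied if
`x < y` in the ordering of the neighbors of `w`. -/
def IsOccupiedLeaf {G : SimpleGraph V} (σ : NeighborOrdering G) (v : V) (l : List V) : Prop :=
  ∃ w x y, ClosesCycle G v l w x y ∧ σ.Precedes w x y

/-- A leaf `v → ⋯ → w → x → ⋯ → y → w` of the self-avoiding walk tree is fixed to be unoccupied if
`x > y` in the ordering of the neighbors of `w`. -/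
def IsUnoccupiedLeaf {G : SimpleGraph V} (σ : NeighborOrdering G) (v : V) (l : List V) : Prop :=
  ∃ w x y, ClosesCycle G v l w x y ∧ σ.Precedes w y x

/-- The vertices of Weitz's tree: from the self-avoiding walk tree, remove every leaf that is fixed
to be unoccupied and, for every leaf `η` that is fixed to be occupied, the whole subtree rooted at
the parent `η.tail` of `η`. -/
def weitzVertices {G : SimpleGraph V} (σ : NeighborOrdering G) (v : V) : Set (List V) :=
  {l | l ∈ sawVertices G v ∧ ¬ IsUnoccupiedLeaf σ v l ∧
    ∀ η, IsOccupiedLeaf σ v η → ¬ η.tail <:+ l}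

/-- Weitz's self-avoiding walk tree of `G`, rooted at (the trivial walk at) `v`, for the neighbor
ordering `σ`. -/
def weitzTree {G : SimpleGraph V} (σ : NeighborOrdering G) (v : V) :
    SimpleGraph (weitzVertices σ v) :=
  (walkGraph V).induce (weitzVertices σ v)

end SawTree

/-- The square lattice `ℤ²`. -/
def squareLattice : SimpleGraph (ℤ × ℤ) where
  Adj p q := |p.1 - q.1| + |p.2 - q.2| = 1
  symm := ⟨fun p q h => by simpa only [abs_sub_comm] using h⟩
  loopless := ⟨fun p h => by simp at h⟩

/-- A neighbor ordering of `ℤ²` is homogeneous if it is the same ordering of the four directions at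
every vertex. -/
def NeighborOrdering.IsHomogeneous (σ : NeighborOrdering squareLattice) : Prop :=
  ∀ w w' d e : ℤ × ℤ, σ.Precedes w (w + d) (w + e) ↔ σ.Precedes w' (w' + d) (w' + e)

/-! Fix a lattice direction `n` and a perpendicular one `e`, and keep only the walks that step by
`n` or `±e`, never by `-n`. They are words in the letters `0` and `±1`. A self-avoiding walk
survives in Weitz's tree if it never reaches a neighbor `y` of an earlier vertex `w`, left through
`x ≠ y`, with `x < y` at `w`. Two local rules ensure this. If a sideways step may be reversed only
after a step `n` (`lastLetter`), a cycle can be closed only from `y = w + n`, after a sideways first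
step; for homogeneous `σ` let `n` be the least direction, and `x < y` fails. If reversal after a
single step `n` is forbidden as well (`lastTurn`), the walk never comes next to an earlier vertex
other than its predecessor, and `σ` plays no role.

The resulting trees have two and three types of vertices. On a tree the occupation ratios satisfy `R
= lam * ∏ 1 / (1 + R_child)`, an order-reversing map `F` (`freeProb_succ`). If `y ≤ F x`, `F y ≤ x`
and `x < y` at the root, the free-boundary ratios at the root stay below `x` at even depths and
above `y` at odd depths (`freeProb_alternates`). For the first rule an explicit period-two orbit
exists when `lam > 3`; for the second, numerical values work when `lam > 3.4`.

A fully occupied level `n + 1` acts as a free boundary at depth `n`, an empty one as a free boundary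
at depth `n + 1`. The two therefore differ at the root by a fixed `δ > 0` at every depth, which
excludes WSM on the subtree. In the whole tree the vertices off the subtree are fixed to be
unoccupied in both boundary conditions, so they disappear, and SSM fails. -/

/-! ### Partition functions: deletion, factorization, embeddings -/

section IndepSum

variable {V : Type*}

open Classical in
/-- The partition function of the hard-core model on the finite set `R` of vertices. -/
noncomputable def indepSum (G : SimpleGraph V) (lam : ℝ) (R : Finset V) : ℝ :=
  ∑ I ∈ R.powerset, if G.IsIndepSet (I : Set V) then lam ^ I.card else 0

open Classical in
theorem indepSum_eq_sum_filter (G : SimpleGraph V) (lam : ℝ) (R : Finset V) :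
    indepSum G lam R =
      ∑ I ∈ R.powerset.filter (fun I : Finset V => G.IsIndepSet (I : Set V)), lam ^ I.card := by
  rw [indepSum, Finset.sum_filter]

theorem indepSum_empty (G : SimpleGraph V) (lam : ℝ) : indepSum G lam ∅ = 1 := by
  simp [indepSum, SimpleGraph.IsIndepSet]

theorem indepSum_pos (G : SimpleGraph V) {lam : ℝ} (hlam : 0 < lam) (R : Finset V) :
    0 < indepSum G lam R := by
  classical
  refine Finset.sum_pos' (fun I _ => by split_ifs <;> positivity) ⟨∅, by simp, ?_⟩
  simp [SimpleGraph.IsIndepSet]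

open Classical in
theorem indepSum_insert [DecidableEq V] (G : SimpleGraph V) (lam : ℝ) {a : V} {P : Finset V} (ha : a ∉ P) :
    indepSum G lam (insert a P) =
      indepSum G lam P + lam * indepSum G lam (P.filter fun b => ¬ G.Adj a b) := by
  unfold indepSum
  rw [Finset.sum_powerset_insert ha, Finset.mul_sum]
  congr 1
  have hsub : (P.filter fun b => ¬ G.Adj a b).powerset ⊆ P.powerset :=
    Finset.powerset_mono.2 (Finset.filter_subset _ _)
  rw [← Finset.sum_subset hsub]
  · refine Finset.sum_congr rfl fun t ht => ?_
    have ht' := Finset.mem_powerset.1 ht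
    have hat : a ∉ t := fun h => ha (Finset.mem_of_mem_filter _ (ht' h))
    have key : G.IsIndepSet ((insert a t : Finset V) : Set V) ↔ G.IsIndepSet (t : Set V) := by
      rw [Finset.coe_insert, SimpleGraph.IsIndepSet, SimpleGraph.IsIndepSet, Set.pairwise_insert]
      refine and_iff_left fun b hb _ => ?_
      have hab := (Finset.mem_filter.1 (ht' hb)).2
      exact ⟨hab, fun h => hab h.symm⟩
    rw [Finset.card_insert_of_notMem hat]
    simp only [key]
    split_ifs
    · ring
    · ring
  · intro t ht ht'
    rw [if_neg]
    intro hind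
    apply ht'
    rw [Finset.mem_powerset] at ht ⊢
    intro b hb
    refine Finset.mem_filter.2 ⟨ht hb, ?_⟩
    exact hind (by simp) (by simp [hb]) (fun h => ha (h ▸ ht hb))

theorem indepSum_union [DecidableEq V] (G : SimpleGraph V) (lam : ℝ) (P Q : Finset V)
    (hd : Disjoint P Q) (hadj : ∀ a ∈ P, ∀ b ∈ Q, ¬ G.Adj a b) :
    indepSum G lam (P ∪ Q) = indepSum G lam P * indepSum G lam Q := by
  classical
  induction hn : P.card using Nat.strong_induction_on generalizing P with
  | _ n ih =>
    rcases P.eq_empty_or_nonempty with rfl | ⟨a, ha⟩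
    · simp [indepSum_empty]
    · obtain ⟨P', ha', rfl⟩ : ∃ P', a ∉ P' ∧ insert a P' = P :=
        ⟨P.erase a, Finset.notMem_erase a P, Finset.insert_erase ha⟩
      have hcard : P'.card < n := by rw [← hn, Finset.card_insert_of_notMem ha']; omega
      rw [Finset.disjoint_insert_left] at hd
      have haQ : a ∉ P' ∪ Q := by simp [ha', hd.1]
      have hfilter : (P' ∪ Q).filter (fun b => ¬ G.Adj a b) =
          P'.filter (fun b => ¬ G.Adj a b) ∪ Q := by
        rw [Finset.filter_union, Finset.filter_true_of_mem (s := Q)]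
        exact fun b hb => hadj a (by simp) b hb
      have e₁ := ih _ hcard P' hd.2 (fun x hx => hadj x (by simp [hx])) rfl
      have e₂ := ih _ ((Finset.card_filter_le P' (fun b => ¬ G.Adj a b)).trans_lt hcard) _
        (hd.2.mono_left (Finset.filter_subset _ _))
        (fun x hx => hadj x (by simp [Finset.mem_of_mem_filter _ hx])) rfl
      have e₃ := indepSum_insert G lam haQ
      have e₄ := indepSum_insert G lam ha'
      rw [hfilter] at e₃
      rw [Finset.insert_union, e₃, e₄, e₁, e₂]
      ring

theorem indepSum_biUnion {ι : Type*} [DecidableEq V] (G : SimpleGraph V) (lam : ℝ)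
    (s : Finset ι) (P : ι → Finset V)
    (hP : ∀ i ∈ s, ∀ j ∈ s, i ≠ j → ∀ a ∈ P i, ∀ b ∈ P j, a ≠ b ∧ ¬ G.Adj a b) :
    indepSum G lam (s.biUnion P) = ∏ i ∈ s, indepSum G lam (P i) := by
  classical
  induction s using Finset.induction_on with
  | empty => simp [indepSum_empty]
  | insert i s hi ih =>
    rw [Finset.biUnion_insert, Finset.prod_insert hi, indepSum_union,
      ih fun i hi j hj => hP i (by simp [hi]) j (by simp [hj])]
    · rw [Finset.disjoint_left]
      intro a ha ha'
      obtain ⟨j, hj, haj⟩ := Finset.mem_biUnion.1 ha'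
      exact (hP i (by simp) j (by simp [hj]) (fun h => hi (h ▸ hj)) a ha a haj).1 rfl
    · intro a ha b hb
      obtain ⟨j, hj, hbj⟩ := Finset.mem_biUnion.1 hb
      exact (hP i (by simp) j (by simp [hj]) (fun h => hi (h ▸ hj)) a ha b hbj).2

theorem hardCoreWeight_true (G : SimpleGraph V) (lam : ℝ) (R : Finset V) :
    hardCoreWeight G lam R ∅ (fun _ => True) = indepSum G lam R := by
  classical
  simp [hardCoreWeight, indepSum, Finset.sum_filter]

theorem hardCoreWeight_notMem [DecidableEq V] (G : SimpleGraph V) (lam : ℝ) (R : Finset V)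
    (v : V) :
    hardCoreWeight G lam R ∅ (fun J => v ∉ J) = indepSum G lam (R.erase v) := by
  classical
  rw [indepSum_eq_sum_filter, hardCoreWeight]
  refine Finset.sum_congr ?_ fun _ _ => rfl
  ext I
  simp only [Finset.mem_filter, Finset.mem_powerset, Set.union_empty, Finset.mem_coe,
    Finset.subset_erase]
  tauto

/-- The hard-core weights are invariant under graph embeddings. -/
theorem hardCoreWeight_map {W : Type*} {H : SimpleGraph W} {G : SimpleGraph V} (φ : H ↪g G)
    (lam : ℝ) (R : Finset W) (A : Set W) (P : Set V → Prop) :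
    hardCoreWeight G lam (R.map φ.toEmbedding) (φ '' A) P =
      hardCoreWeight H lam R A (fun J => P (φ '' J)) := by
  classical
  have himg : ∀ I : Finset W, ((I.map φ.toEmbedding : Finset V) : Set V) ∪ φ '' A =
      φ '' ((I : Set W) ∪ A) := fun I => by
    rw [Set.image_union, Finset.coe_map]; rfl
  have hind : ∀ J : Set W, G.IsIndepSet (φ '' J) ↔ H.IsIndepSet J := fun J => by
    unfold SimpleGraph.IsIndepSet
    rw [φ.injective.injOn.pairwise_image]
    simp [Set.Pairwise, Function.onFun]
  symm
  unfold hardCoreWeight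
  refine Finset.sum_bij (fun I _ => I.map φ.toEmbedding) ?_ ?_ ?_ ?_
  · intro I hI
    simp only [Finset.mem_filter, Finset.mem_powerset] at hI ⊢
    rw [himg, hind]
    exact ⟨Finset.map_subset_map.2 hI.1, hI.2⟩
  · intro I _ J _ h
    exact Finset.map_injective _ h
  · intro J hJ
    simp only [Finset.mem_filter, Finset.mem_powerset] at hJ
    obtain ⟨I, hI, rfl⟩ := Finset.subset_map_iff.1 hJ.1
    refine ⟨I, ?_, rfl⟩
    rw [himg, hind] at hJ
    simp only [Finset.mem_filter, Finset.mem_powerset]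
    exact ⟨hI, hJ.2⟩
  · intro I _
    rw [Finset.card_map]

/-- Vertices outside the range of `φ` lie outside the region and are unoccupied, so they impose no
constraint. This reduces a subtree of Weitz's tree to an abstract tree of words. -/
theorem unoccupiedProb_map {W : Type*} {H : SimpleGraph W} {G : SimpleGraph V} (φ : H ↪g G)
    (lam : ℝ) (R : Finset W) (A : Set W) (v : W) :
    unoccupiedProb G lam (R.map φ.toEmbedding) (φ '' A) (φ v) = unoccupiedProb H lam R A v := by
  unfold unoccupiedProb
  rw [hardCoreWeight_map, hardCoreWeight_map]
  simp [φ.injective.mem_set_image]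

end IndepSum

/-! ### Trees of words and the hard-core recursion -/

section WordTree

variable {α : Type*} [DecidableEq α]

/-- The words that extend `w` by fewer than `n` letters, where the letters that may follow a word
`u` are those of `K u`. Words are written with the latest letter first. -/
def descendants (K : List α → Finset α) : ℕ → List α → Finset (List α)
  | 0, _ => ∅
  | n + 1, w => insert w ((K w).biUnion fun d => descendants K n (d :: w))

/-- Each letter of the word is one of those that may follow the letters before it. -/
def Admissible (K : List α → Finset α) : List α → Prop
  | [] => True
  | d :: w => d ∈ K w ∧ Admissible K w

omit [DecidableEq α] in
theorem Admissible.of_suffix {K : List α → Finset α} {u w : List α} (hu : Admissible K u)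
    (h : w <:+ u) : Admissible K w := by
  obtain ⟨p, rfl⟩ := h
  induction p with
  | nil => exact hu
  | cons d p ih => exact ih hu.2

theorem mem_descendants {K : List α → Finset α} {n : ℕ} {u w : List α} (hw : Admissible K w) :
    u ∈ descendants K n w ↔ w <:+ u ∧ Admissible K u ∧ u.length < w.length + n := by
  induction n generalizing w with
  | zero =>
    simp only [descendants, Finset.notMem_empty, false_iff]
    rintro ⟨h, -, h'⟩
    have := h.length_le
    omega
  | succ n ih =>
    simp only [descendants, Finset.mem_insert, Finset.mem_biUnion]
    constructor
    · rintro (rfl | ⟨d, hd, hu⟩)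
      · exact ⟨List.suffix_rfl, hw, by omega⟩
      · obtain ⟨h₁, h₂, h₃⟩ := (ih (w := d :: w) ⟨hd, hw⟩).1 hu
        exact ⟨(List.suffix_cons d w).trans h₁, h₂, by simp at h₃; omega⟩
    · rintro ⟨⟨p, rfl⟩, hu, hlen⟩
      -- Words grow on the left, so the letter that follows `w` is the last one of `p`.
      rcases p.eq_nil_or_concat' with rfl | ⟨q, d, rfl⟩
      · exact Or.inl rfl
      · have hs : d :: w <:+ (q ++ [d]) ++ w := ⟨q, by simp⟩
        have hdw := hu.of_suffix hs
        refine Or.inr ⟨d, hdw.1, (ih hdw).2 ⟨hs, hu, ?_⟩⟩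
        simp at hlen ⊢
        omega

theorem suffix_of_mem_descendants {K : List α → Finset α} {n : ℕ} {u w : List α}
    (h : u ∈ descendants K n w) : w <:+ u := by
  induction n generalizing w with
  | zero => simp [descendants] at h
  | succ n ih =>
    simp only [descendants, Finset.mem_insert, Finset.mem_biUnion] at h
    rcases h with rfl | ⟨d, -, hu⟩
    · exact List.suffix_rfl
    · exact (List.suffix_cons d w).trans (ih hu)

omit [DecidableEq α] in
theorem length_of_walkGraph_adj {u w : List α} (h : (walkGraph α).Adj u w) :
    w.length = u.length + 1 ∨ u.length = w.length + 1 := by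
  rcases h with ⟨d, rfl⟩ | ⟨d, rfl⟩ <;> simp

omit [DecidableEq α] in
theorem eq_of_cons_suffix_of_cons_suffix {d e : α} {w u : List α} (h₁ : d :: w <:+ u)
    (h₂ : e :: w <:+ u) : d = e := by
  have := List.suffix_of_suffix_length_le h₁ h₂ (by simp)
  have := this.eq_of_length (by simp)
  exact (List.cons.inj this).1

omit [DecidableEq α] in
theorem not_walkGraph_adj_of_cons_suffix {d e : α} {w a b : List α} (hde : d ≠ e)
    (ha : d :: w <:+ a) (hb : e :: w <:+ b) : a ≠ b ∧ ¬ (walkGraph α).Adj a b := by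
  refine ⟨fun h => hde (eq_of_cons_suffix_of_cons_suffix (h ▸ ha) hb), ?_⟩
  rintro (⟨x, rfl⟩ | ⟨x, rfl⟩)
  · exact hde (eq_of_cons_suffix_of_cons_suffix (ha.trans (List.suffix_cons _ _)) hb)
  · exact hde (eq_of_cons_suffix_of_cons_suffix ha (hb.trans (List.suffix_cons _ _)))

theorem erase_descendants_succ (K : List α → Finset α) (n : ℕ) (w : List α) :
    (descendants K (n + 1) w).erase w = (K w).biUnion fun d => descendants K n (d :: w) := by
  rw [descendants, Finset.erase_insert]
  intro h
  obtain ⟨d, -, h⟩ := Finset.mem_biUnion.1 h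
  have := (suffix_of_mem_descendants h).length_le
  simp at this

open Classical in
theorem filter_not_adj_biUnion_descendants (K : List α → Finset α) (n : ℕ) (w : List α) :
    ((K w).biUnion fun d => descendants K n (d :: w)).filter (fun u => ¬ (walkGraph α).Adj w u) =
      (K w).biUnion fun d => (descendants K n (d :: w)).erase (d :: w) := by
  rw [Finset.filter_biUnion]
  refine Finset.biUnion_congr rfl fun d _ => ?_
  ext u
  simp only [Finset.mem_filter, Finset.mem_erase]
  rw [and_comm, and_congr_left_iff]
  intro hu
  have hs := suffix_of_mem_descendants hu
  rw [not_iff_not]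
  constructor
  · rintro (⟨x, rfl⟩ | ⟨x, rfl⟩)
    · exact (hs.eq_of_length (by simp)).symm
    · have := hs.length_le
      simp at this
  · rintro rfl
    exact Or.inl ⟨d, rfl⟩

variable (K : List α → Finset α) (lam : ℝ)

/-- The probability that `w` is unoccupied in the hard-core model on the tree of the words that
extend `w` by fewer than `n` letters. -/
noncomputable def freeProb (n : ℕ) (w : List α) : ℝ :=
  indepSum (walkGraph α) lam ((descendants K n w).erase w) /
    indepSum (walkGraph α) lam (descendants K n w)

theorem freeProb_zero (w : List α) : freeProb K lam 0 w = 1 := by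
  simp [freeProb, descendants, indepSum_empty]

/-- If `w` is unoccupied, the branches at its children are independent; if `w` is occupied, the
children are deleted and what remains is again independent. The quotient of the two weights is `lam`
times the product of the children's probabilities. -/
theorem freeProb_succ {lam : ℝ} (hlam : 0 < lam) (n : ℕ) (w : List α) :
    freeProb K lam (n + 1) w = 1 / (1 + lam * ∏ d ∈ K w, freeProb K lam n (d :: w)) := by
  classical
  set G := walkGraph α with hG
  have hsep : ∀ i ∈ K w, ∀ j ∈ K w, i ≠ j → ∀ a ∈ descendants K n (i :: w),
      ∀ b ∈ descendants K n (j :: w), a ≠ b ∧ ¬ G.Adj a b := fun i _ j _ hij a ha b hb =>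
    not_walkGraph_adj_of_cons_suffix hij (suffix_of_mem_descendants ha)
      (suffix_of_mem_descendants hb)
  have h₁ : indepSum G lam ((descendants K (n + 1) w).erase w) =
      ∏ d ∈ K w, indepSum G lam (descendants K n (d :: w)) := by
    rw [erase_descendants_succ, indepSum_biUnion _ _ _ _ hsep]
  have h₂ : indepSum G lam (descendants K (n + 1) w) =
      ∏ d ∈ K w, indepSum G lam (descendants K n (d :: w)) +
        lam * ∏ d ∈ K w, indepSum G lam ((descendants K n (d :: w)).erase (d :: w)) := by
    rw [← Finset.insert_erase (show w ∈ descendants K (n + 1) w by simp [descendants]),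
      indepSum_insert _ _ (Finset.notMem_erase _ _), h₁, erase_descendants_succ,
      filter_not_adj_biUnion_descendants, indepSum_biUnion]
    exact fun i hi j hj hij a ha b hb =>
      hsep i hi j hj hij a (Finset.mem_of_mem_erase ha) b (Finset.mem_of_mem_erase hb)
  have hpos : 0 < ∏ d ∈ K w, indepSum G lam (descendants K n (d :: w)) :=
    Finset.prod_pos fun d _ => indepSum_pos G hlam _
  have hpos' : 0 < ∏ d ∈ K w, indepSum G lam ((descendants K n (d :: w)).erase (d :: w)) :=
    Finset.prod_pos fun d _ => indepSum_pos G hlam _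
  simp only [freeProb, ← hG]
  rw [h₁, h₂, Finset.prod_div_distrib]
  field_simp

theorem freeProb_pos {lam : ℝ} (hlam : 0 < lam) (n : ℕ) (w : List α) : 0 < freeProb K lam n w :=
  div_pos (indepSum_pos _ hlam _) (indepSum_pos _ hlam _)

/-- If the occupation ratios `x ≤ y` satisfy `y ≤ F x` and `F y ≤ x` for the tree recursion `F`,
then the free-boundary occupation ratios stay below `x` at even depths and above `y` at odd
depths. -/
theorem freeProb_alternates {K : List α → Finset α} {lam : ℝ} (hlam : 0 < lam)
    {x y : List α → ℝ} (hx : ∀ w, 0 ≤ x w) (hy : ∀ w, 0 ≤ y w)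
    (hyx : ∀ w, y w * ∏ d ∈ K w, (1 + x (d :: w)) ≤ lam)
    (hxy : ∀ w, lam ≤ x w * ∏ d ∈ K w, (1 + y (d :: w))) (k : ℕ) (w : List α) :
    1 / (1 + x w) ≤ freeProb K lam (2 * k) w ∧
      freeProb K lam (2 * k + 1) w ≤ 1 / (1 + y w) := by
  have odd_of_even : ∀ n, (∀ w, 1 / (1 + x w) ≤ freeProb K lam n w) →
      ∀ w, freeProb K lam (n + 1) w ≤ 1 / (1 + y w) := fun n h w => by
    rw [freeProb_succ K hlam]
    have hP : 0 < ∏ d ∈ K w, (1 + x (d :: w)) :=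
      Finset.prod_pos fun d _ => by linarith [hx (d :: w)]
    have h₁ : ∏ d ∈ K w, (1 / (1 + x (d :: w))) ≤ ∏ d ∈ K w, freeProb K lam n (d :: w) :=
      Finset.prod_le_prod (fun d _ => by have := hx (d :: w); positivity) fun d _ => h _
    rw [Finset.prod_div_distrib, Finset.prod_const_one] at h₁
    have h₂ : y w ≤ lam * (1 / ∏ d ∈ K w, (1 + x (d :: w))) := by
      rw [mul_one_div, le_div_iff₀ hP]
      exact hyx w
    have h₃ := mul_le_mul_of_nonneg_left h₁ hlam.le
    exact one_div_le_one_div_of_le (by linarith [hy w]) (by linarith)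
  have even_of_odd : ∀ n, (∀ w, freeProb K lam n w ≤ 1 / (1 + y w)) →
      ∀ w, 1 / (1 + x w) ≤ freeProb K lam (n + 1) w := fun n h w => by
    rw [freeProb_succ K hlam]
    have hP : 0 < ∏ d ∈ K w, (1 + y (d :: w)) :=
      Finset.prod_pos fun d _ => by linarith [hy (d :: w)]
    have hF : 0 < ∏ d ∈ K w, freeProb K lam n (d :: w) :=
      Finset.prod_pos fun d _ => freeProb_pos K hlam _ _
    have h₁ : ∏ d ∈ K w, freeProb K lam n (d :: w) ≤ ∏ d ∈ K w, (1 / (1 + y (d :: w))) :=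
      Finset.prod_le_prod (fun d _ => (freeProb_pos K hlam _ _).le) fun d _ => h _
    rw [Finset.prod_div_distrib, Finset.prod_const_one] at h₁
    have h₂ : lam * (1 / ∏ d ∈ K w, (1 + y (d :: w))) ≤ x w := by
      rw [mul_one_div, div_le_iff₀ hP]
      exact hxy w
    have h₃ := mul_le_mul_of_nonneg_left h₁ hlam.le
    exact one_div_le_one_div_of_le (by positivity) (by linarith)
  have main : ∀ k w, 1 / (1 + x w) ≤ freeProb K lam (2 * k) w := by
    intro k
    induction k with
    | zero =>
      intro w
      -- At depth `0` the region is empty and the probability is `1`, that is, the ratio is `0 ≤ x`.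
      rw [mul_zero, freeProb_zero]
      exact (div_le_one (by linarith [hx w])).2 (by linarith [hx w])
    | succ k ih => exact even_of_odd _ (odd_of_even _ ih)
  exact ⟨main k w, odd_of_even _ (main k) w⟩

end WordTree

/-! ### From oscillation at the root to failure of mixing -/

section Mixing

variable {α : Type*} [DecidableEq α]

/-- The admissible words with `n` letters. -/
def admissibleLevel (K : List α → Finset α) (n : ℕ) : Set (List α) :=
  {w | Admissible K w ∧ w.length = n}

theorem mem_descendants_nil {K : List α → Finset α} {n : ℕ} {u : List α} :
    u ∈ descendants K n [] ↔ Admissible K u ∧ u.length < n := by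
  rw [mem_descendants (show Admissible K [] from trivial)]
  simp

/-- The tree of the admissible words. -/
def admissibleTree (K : List α → Finset α) : SimpleGraph {w : List α | Admissible K w} :=
  (walkGraph α).induce {w | Admissible K w}

/-- Every word of length `n` has a child, which is occupied, so level `n` is forced to be empty;
shorter words are not adjacent to level `n + 1`. -/
theorem hardCoreWeight_admissibleLevel {K : List α → Finset α} (hK : ∀ w, (K w).Nonempty)
    (lam : ℝ) (n : ℕ) (P : Set (List α) → Prop)
    (hP : ∀ J, P (J ∪ admissibleLevel K (n + 1)) ↔ P J) :
    hardCoreWeight (walkGraph α) lam (descendants K (n + 1) []) (admissibleLevel K (n + 1)) P =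
      hardCoreWeight (walkGraph α) lam (descendants K n []) ∅ P := by
  unfold hardCoreWeight
  refine Finset.sum_congr ?_ fun _ _ => rfl
  ext I
  simp only [Finset.mem_filter, Finset.mem_powerset, Set.union_empty, hP]
  constructor
  · rintro ⟨hI, hind, hp⟩
    refine ⟨fun u hu => ?_, hind.mono Set.subset_union_left, hp⟩
    have hu' := mem_descendants_nil.1 (hI hu)
    refine mem_descendants_nil.2 ⟨hu'.1, ?_⟩
    by_contra hlen
    have hlen' : u.length = n := by omega
    obtain ⟨d, hd⟩ := hK u
    exact hind (Or.inl hu) (Or.inr ⟨⟨hd, hu'.1⟩, by simp [hlen']⟩ : d :: u ∈ _)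
      (fun h => by simpa using congrArg List.length h) (Or.inl ⟨d, rfl⟩)
  · rintro ⟨hI, hind, hp⟩
    refine ⟨fun u hu => ?_, ?_, hp⟩
    · have hu' := mem_descendants_nil.1 (hI hu)
      exact mem_descendants_nil.2 ⟨hu'.1, by omega⟩
    · rintro a (ha | ha) b (hb | hb) hab h
      · exact hind ha hb hab h
      · have h₁ := (mem_descendants_nil.1 (hI ha)).2
        have h₂ := hb.2
        have := length_of_walkGraph_adj h
        omega
      · have h₁ := (mem_descendants_nil.1 (hI hb)).2
        have h₂ := ha.2
        have := length_of_walkGraph_adj h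
        omega
      · have h₁ := ha.2
        have h₂ := hb.2
        have := length_of_walkGraph_adj h
        omega

theorem unoccupiedProb_descendants (K : List α → Finset α) (lam : ℝ) (n : ℕ) :
    unoccupiedProb (walkGraph α) lam (descendants K n []) ∅ [] = freeProb K lam n [] := by
  rw [unoccupiedProb, hardCoreWeight_true, hardCoreWeight_notMem, freeProb]

theorem unoccupiedProb_admissibleLevel {K : List α → Finset α} (hK : ∀ w, (K w).Nonempty)
    (lam : ℝ) (n : ℕ) :
    unoccupiedProb (walkGraph α) lam (descendants K (n + 1) []) (admissibleLevel K (n + 1)) [] =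
      freeProb K lam n [] := by
  rw [← unoccupiedProb_descendants, unoccupiedProb, unoccupiedProb,
    hardCoreWeight_admissibleLevel hK, hardCoreWeight_admissibleLevel hK]
  · simp
  · intro J
    simp [admissibleLevel]

/-- The hypothesis under which the free-boundary probabilities at the root oscillate: the tree
recursion exchanges the region below `x` and the region above `y`. -/
def HasOscillation (K : List α → Finset α) (lam : ℝ) : Prop :=
  ∃ x y : List α → ℝ, (∀ w, 0 ≤ x w) ∧ (∀ w, 0 ≤ y w) ∧
    (∀ w, y w * ∏ d ∈ K w, (1 + x (d :: w)) ≤ lam) ∧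
    (∀ w, lam ≤ x w * ∏ d ∈ K w, (1 + y (d :: w))) ∧ x [] < y []

theorem HasOscillation.exists_gap {K : List α → Finset α} {lam : ℝ} (hlam : 0 < lam)
    (h : HasOscillation K lam) :
    ∃ δ > 0, ∀ n, δ ≤ |freeProb K lam n [] - freeProb K lam (n + 1) []| := by
  obtain ⟨x, y, hx, hy, hyx, hxy, hlt⟩ := h
  refine ⟨1 / (1 + x []) - 1 / (1 + y []), sub_pos.2 <|
    one_div_lt_one_div_of_lt (by linarith [hx []]) (by linarith), fun n => ?_⟩
  have key := fun k => freeProb_alternates hlam hx hy hyx hxy k []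
  obtain ⟨k, rfl | rfl⟩ := n.even_or_odd'
  · refine le_trans ?_ (le_abs_self _)
    linarith [(key k).1, (key k).2]
  · refine le_trans ?_ (neg_le_abs _)
    have := (key (k + 1)).1
    rw [show 2 * (k + 1) = 2 * k + 1 + 1 by ring] at this
    linarith [(key k).2]

/-- A function that grows by at most one along each edge bounds distances from below; it will be the
length of walks. -/
theorem le_edist_of_length {V : Type*} {G : SimpleGraph V} {ℓ : V → ℕ}
    (hℓ : ∀ a b, G.Adj a b → ℓ b ≤ ℓ a + 1) {a b : V} {n : ℕ} (h : ℓ a + n ≤ ℓ b) :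
    (n : ℕ∞) ≤ G.edist a b := by
  refine le_iInf fun p => ?_
  have : ∀ {a b : V} (p : G.Walk a b), ℓ b ≤ ℓ a + p.length := by
    intro a b p
    induction p with
    | nil => simp
    | cons hab p ih =>
      have := hℓ _ _ hab
      rw [SimpleGraph.Walk.length_cons]
      omega
  have := this p
  exact_mod_cast (by omega : n ≤ p.length)

section Embedding

variable {K : List α → Finset α} {V : Type*} {G : SimpleGraph V} (ψ : admissibleTree K ↪g G)

/-- The image in `G` of the admissible words with fewer than `n` letters. -/
noncomputable def embeddedRegion (n : ℕ) : Finset V := by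
  classical
  exact ((descendants K n []).subtype fun w => w ∈ {w | Admissible K w}).map ψ.toEmbedding

/-- The image in `G` of the admissible words with `n` letters. -/
def embeddedLevel (n : ℕ) : Set V :=
  ψ '' {w | w.1.length = n}

theorem mem_embeddedRegion {n : ℕ} {w : {w : List α | Admissible K w}} :
    ψ w ∈ embeddedRegion ψ n ↔ w.1.length < n := by
  classical
  have h : w.1 ∈ descendants K n [] ↔ w.1.length < n :=
    mem_descendants_nil.trans (and_iff_right w.2)
  rw [← h, embeddedRegion]
  simp only [Finset.mem_map, Finset.mem_subtype]
  constructor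
  · rintro ⟨u, hu, he⟩
    rwa [← ψ.injective he]
  · exact fun h => ⟨w, h, rfl⟩

theorem unoccupiedProb_embeddedRegion (lam : ℝ) (n : ℕ) (A : Set {w : List α | Admissible K w}) :
    unoccupiedProb G lam (embeddedRegion ψ n) (ψ '' A) (ψ ⟨[], trivial⟩) =
      unoccupiedProb (walkGraph α) lam (descendants K n []) (Subtype.val '' A) [] := by
  classical
  rw [embeddedRegion, unoccupiedProb_map]
  have h := unoccupiedProb_map (SimpleGraph.Embedding.induce {w : List α | Admissible K w}
    (G := walkGraph α)) lam ((descendants K n []).subtype fun w => w ∈ {w | Admissible K w}) A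
    ⟨[], trivial⟩
  refine Eq.trans h.symm ?_
  congr 1
  ext u
  constructor
  · intro hu
    obtain ⟨w, hw, rfl⟩ := Finset.mem_map.1 hu
    exact Finset.mem_subtype.1 hw
  · intro hu
    have hu' := (mem_descendants_nil.1 hu).1
    exact Finset.mem_map.2 ⟨⟨u, hu'⟩, Finset.mem_subtype.2 hu, rfl⟩

theorem isBoundaryCondition_embeddedLevel (n : ℕ) :
    IsBoundaryCondition G (embeddedRegion ψ n : Set V)ᶜ (embeddedLevel ψ n) := by
  constructor
  · rintro _ ⟨w, hw, rfl⟩ h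
    have h₁ := (mem_embeddedRegion ψ).1 (Finset.mem_coe.1 h)
    have h₂ : w.1.length = n := hw
    omega
  · rintro _ ⟨w, hw, rfl⟩ _ ⟨u, hu, rfl⟩ _ h
    have hwu : (walkGraph α).Adj w.1 u.1 := ψ.map_adj_iff.1 h
    have := length_of_walkGraph_adj hwu
    have h₁ : w.1.length = n := hw
    have h₂ : u.1.length = n := hu
    omega

theorem isBoundaryCondition_empty (S : Set V) : IsBoundaryCondition G S ∅ :=
  ⟨Set.empty_subset _, Set.pairwise_empty _⟩

theorem exists_gap_of_embedding (hK : ∀ w, (K w).Nonempty) {lam : ℝ} (hlam : 0 < lam)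
    (h : HasOscillation K lam) :
    ∃ δ > 0, ∀ n, δ ≤
      |unoccupiedProb G lam (embeddedRegion ψ (n + 1)) (embeddedLevel ψ (n + 1)) (ψ ⟨[], trivial⟩) -
        unoccupiedProb G lam (embeddedRegion ψ (n + 1)) ∅ (ψ ⟨[], trivial⟩)| := by
  obtain ⟨δ, hδ, hgap⟩ := h.exists_gap hlam
  refine ⟨δ, hδ, fun n => ?_⟩
  have h₁ : unoccupiedProb G lam (embeddedRegion ψ (n + 1)) (embeddedLevel ψ (n + 1))
      (ψ ⟨[], trivial⟩) = freeProb K lam n [] := by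
    rw [embeddedLevel, unoccupiedProb_embeddedRegion, ← unoccupiedProb_admissibleLevel hK]
    congr 1
    ext u
    constructor
    · rintro ⟨w, hw, rfl⟩
      exact ⟨w.2, hw⟩
    · rintro ⟨hu, hlen⟩
      exact ⟨⟨u, hu⟩, hlen, rfl⟩
  have h₂ : unoccupiedProb G lam (embeddedRegion ψ (n + 1)) ∅
      (ψ ⟨[], trivial⟩) = freeProb K lam (n + 1) [] := by
    have := unoccupiedProb_embeddedRegion ψ lam (n + 1) ∅
    rw [Set.image_empty, Set.image_empty] at this
    rw [this, unoccupiedProb_descendants]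
  rw [h₁, h₂]
  exact hgap n

/-- Here `S'` is the embedded level only. All other vertices outside the region, including those off
the subtree and possibly close to the root, are unoccupied in both boundary conditions. -/
theorem not_SSM_of_embedding (hK : ∀ w, (K w).Nonempty) {lam : ℝ} (hlam : 0 < lam)
    (h : HasOscillation K lam) {ℓ : V → ℕ} (hℓ : ∀ a b, G.Adj a b → ℓ b ≤ ℓ a + 1)
    (hψ : ∀ w, ℓ (ψ w) = ℓ (ψ ⟨[], trivial⟩) + w.1.length) : ¬ SSM G lam := by
  rintro ⟨γ, hγ₀, hγ₁, hmix⟩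
  obtain ⟨δ, hδ, hgap⟩ := exists_gap_of_embedding ψ hK hlam h
  obtain ⟨n, hn⟩ := exists_pow_lt_of_lt_one hδ hγ₁
  have hb := isBoundaryCondition_embeddedLevel ψ (n + 1)
  have := hmix (ψ ⟨[], trivial⟩) (embeddedRegion ψ (n + 1)) (embeddedLevel ψ (n + 1))
    (embeddedLevel ψ (n + 1)) ∅ hb.1 hb (isBoundaryCondition_empty _)
    (fun u hu => iff_of_false hu.2 (Set.notMem_empty u)) n ?_
  · linarith [hgap n]
  · refine le_iInf₂ fun s hs => ?_
    obtain ⟨w, hw, rfl⟩ := hs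
    refine le_edist_of_length hℓ ?_
    have hw' : w.1.length = n + 1 := hw
    rw [hψ w]
    omega

/-- Surjectivity puts the whole boundary at words of length at least `n + 1`, hence far from the
root. -/
theorem not_WSM_of_embedding (hK : ∀ w, (K w).Nonempty) {lam : ℝ} (hlam : 0 < lam)
    (h : HasOscillation K lam) (hψs : Function.Surjective ψ) {ℓ : V → ℕ}
    (hℓ : ∀ a b, G.Adj a b → ℓ b ≤ ℓ a + 1)
    (hψ : ∀ w, ℓ (ψ w) = ℓ (ψ ⟨[], trivial⟩) + w.1.length) : ¬ WSM G lam := by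
  rintro ⟨γ, hγ₀, hγ₁, hmix⟩
  obtain ⟨δ, hδ, hgap⟩ := exists_gap_of_embedding ψ hK hlam h
  obtain ⟨n, hn⟩ := exists_pow_lt_of_lt_one hδ hγ₁
  have := hmix (ψ ⟨[], trivial⟩) (embeddedRegion ψ (n + 1)) (embeddedLevel ψ (n + 1)) ∅
    (isBoundaryCondition_embeddedLevel ψ (n + 1)) (isBoundaryCondition_empty _) n ?_
  · linarith [hgap n]
  · refine le_iInf₂ fun s hs => ?_
    obtain ⟨w, rfl⟩ := hψs s
    refine le_edist_of_length hℓ ?_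
    have hw : ¬ w.1.length < n + 1 := fun h => hs ((mem_embeddedRegion ψ).2 h)
    rw [hψ w]
    omega

end Embedding

omit [DecidableEq α] in
-- Each edge joining `w` to `d :: w` is a bridge: the set of words extending `d :: w` is closed
-- under every other edge.
theorem isAcyclic_walkGraph : (walkGraph α).IsAcyclic := by
  have key : ∀ (d : α) (w : List α), (walkGraph α).IsBridge s(w, d :: w) := by
    intro d w
    rw [SimpleGraph.isBridge_iff]
    refine fun hr => ?_
    have hinv : ∀ {a b : List α}, ((walkGraph α).deleteEdges {s(w, d :: w)}).Walk a b →
        d :: w <:+ b → d :: w <:+ a := by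
      intro a b p
      induction p with
      | nil => exact id
      | cons hab p ih =>
        intro hb
        have hs := ih hb
        rw [SimpleGraph.deleteEdges_adj] at hab
        obtain ⟨⟨x, rfl⟩ | ⟨x, rfl⟩, hne⟩ := hab
        · rcases List.suffix_cons_iff.1 hs with h | h
          · obtain ⟨rfl, rfl⟩ := List.cons.inj h
            simp at hne
          · exact h
        · exact hs.trans (List.suffix_cons _ _)
    obtain ⟨p⟩ := hr
    have := (hinv p List.suffix_rfl).length_le
    simp at this
  rw [SimpleGraph.isAcyclic_iff_forall_adj_isBridge]
  rintro a b (⟨d, rfl⟩ | ⟨d, rfl⟩)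
  · exact key d a
  · rw [Sym2.eq_swap]
    exact key d b

omit [DecidableEq α] in
theorem isTree_admissibleTree (K : List α → Finset α) : (admissibleTree K).IsTree := by
  have hroot : ∀ (w : List α) (hw : Admissible K w),
      (admissibleTree K).Reachable ⟨[], trivial⟩ ⟨w, hw⟩ := by
    intro w
    induction w with
    | nil => exact fun _ => SimpleGraph.Reachable.refl _
    | cons d w ih =>
      intro hw
      refine (ih hw.2).trans (SimpleGraph.Adj.reachable ?_)
      exact Or.inl ⟨d, rfl⟩
  have : Nonempty {w : List α | Admissible K w} := ⟨⟨[], trivial⟩⟩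
  refine ⟨⟨fun a b => (hroot a.1 a.2).symm.trans (hroot b.1 b.2)⟩, ?_⟩
  exact isAcyclic_walkGraph.induce _

end Mixing

/-! ### Lattice walks coded by words, inside Weitz's tree -/

section Trail

/-- Adding the vectors `e` and `n` is a parametrization of `ℤ²` by coordinates which preserves the
`ℓ¹` norm. -/
def IsLatticeFrame (e n : ℤ × ℤ) : Prop :=
  ∀ a b : ℤ, |(a • e + b • n).1| + |(a • e + b • n).2| = |a| + |b|

/-- The number of steps `e` minus the number of steps `-e`. -/
def sideways : List SignType → ℤ
  | [] => 0
  | s :: w => sideways w + s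

/-- The number of steps `n`. -/
def height : List SignType → ℤ
  | [] => 0
  | s :: w => height w + if s = 0 then 1 else 0

/-- The end point of the walk from `v` that steps by `n` at each letter `0` and by `s • e` at each
letter `s = ± 1`. -/
def endpoint (e n v : ℤ × ℤ) (w : List SignType) : ℤ × ℤ :=
  v + (sideways w • e + height w • n)

/-- The walk from `v` that steps by `n` at each letter `0` and by `s • e` at each letter
`s = ± 1`, with its last vertex first. -/
def trail (e n v : ℤ × ℤ) : List SignType → List (ℤ × ℤ)
  | [] => [endpoint e n v []]
  | s :: w => endpoint e n v (s :: w) :: trail e n v w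

theorem sideways_append (p s : List SignType) : sideways (p ++ s) = sideways p + sideways s := by
  induction p with
  | nil => simp [sideways]
  | cons d p ih => simp only [List.cons_append, sideways, ih]; ring

theorem height_append (p s : List SignType) : height (p ++ s) = height p + height s := by
  induction p with
  | nil => simp [height]
  | cons d p ih => simp only [List.cons_append, height, ih]; ring

theorem height_nonneg (p : List SignType) : 0 ≤ height p := by
  induction p with
  | nil => simp [height]
  | cons d p ih => rw [height]; split_ifs <;> omega

variable {e n v : ℤ × ℤ}

theorem endpoint_append (p s : List SignType) :
    endpoint e n v (p ++ s) = endpoint e n v s + (sideways p • e + height p • n) := by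
  simp only [endpoint, sideways_append, height_append, add_smul]
  abel

theorem squareLattice_adj_add {q d : ℤ × ℤ} : squareLattice.Adj (q + d) q ↔ |d.1| + |d.2| = 1 := by
  simp [squareLattice]

theorem squareLattice_adj_endpoint (hen : IsLatticeFrame e n) (p s : List SignType) :
    squareLattice.Adj (endpoint e n v (p ++ s)) (endpoint e n v s) ↔
      |sideways p| + |height p| = 1 := by
  rw [endpoint_append, squareLattice_adj_add, hen]

theorem endpoint_append_eq_iff (hen : IsLatticeFrame e n) (p s : List SignType) :
    endpoint e n v (p ++ s) = endpoint e n v s ↔ sideways p = 0 ∧ height p = 0 := by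
  rw [endpoint_append, add_eq_left]
  constructor
  · intro h
    have := hen (sideways p) (height p)
    rw [h] at this
    simp only [Prod.fst_zero, Prod.snd_zero, abs_zero, add_zero] at this
    have h₁ := abs_nonneg (sideways p)
    have h₂ := abs_nonneg (height p)
    exact ⟨abs_eq_zero.1 (by omega), abs_eq_zero.1 (by omega)⟩
  · rintro ⟨h₁, h₂⟩
    simp [h₁, h₂]

theorem trail_eq_cons (w : List SignType) :
    ∃ l, trail e n v w = endpoint e n v w :: l := by
  cases w <;> exact ⟨_, rfl⟩

theorem length_trail (w : List SignType) : (trail e n v w).length = w.length + 1 := by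
  induction w with
  | nil => rfl
  | cons d w ih => simp [trail, ih]

theorem exists_of_suffix_trail {u : List SignType} {l : List (ℤ × ℤ)} (hl : l ≠ [])
    (h : l <:+ trail e n v u) : ∃ s, s <:+ u ∧ l = trail e n v s := by
  induction u with
  | nil =>
    rcases List.suffix_cons_iff.1 h with h | h
    · exact ⟨[], List.suffix_rfl, h⟩
    · exact absurd (List.suffix_nil.1 h) hl
  | cons d u ih =>
    rcases List.suffix_cons_iff.1 h with h | h
    · exact ⟨d :: u, List.suffix_rfl, h⟩
    · obtain ⟨s, hs, rfl⟩ := ih h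
      exact ⟨s, hs.trans (List.suffix_cons _ _), rfl⟩

theorem exists_endpoint_of_mem_trail {u : List SignType} {z : ℤ × ℤ} (h : z ∈ trail e n v u) :
    ∃ s, s <:+ u ∧ z = endpoint e n v s := by
  obtain ⟨a, b, hab⟩ := List.append_of_mem h
  obtain ⟨s, hs, hz⟩ := exists_of_suffix_trail (l := z :: b) (by simp) ⟨a, hab.symm⟩
  obtain ⟨l, hl⟩ := trail_eq_cons (e := e) (n := n) (v := v) s
  rw [hl] at hz
  exact ⟨s, hs, (List.cons.inj hz).1⟩

theorem trail_injective (hen : IsLatticeFrame e n) : Function.Injective (trail e n v) := by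
  intro u
  induction u with
  | nil =>
    intro w h
    have := congrArg List.length h
    rw [length_trail, length_trail] at this
    exact (List.length_eq_zero_iff.1 (by simpa using this.symm)).symm
  | cons d u ih =>
    rintro (_ | ⟨d', w⟩) h
    · simpa [length_trail] using congrArg List.length h
    · obtain ⟨h₁, h₂⟩ := List.cons.inj h
      obtain rfl := ih h₂
      have h₃ : ((d : ℤ) - d') • e + ((if d = 0 then 1 else 0 : ℤ) - if d' = 0 then 1 else 0) • n
          = 0 := by
        simp only [endpoint, sideways, height, add_right_inj] at h₁
        rw [sub_smul, sub_smul]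
        simp only [add_smul] at h₁
        linear_combination (exp := 1) h₁
      have h₄ := hen ((d : ℤ) - d') ((if d = 0 then 1 else 0 : ℤ) - if d' = 0 then 1 else 0)
      rw [h₃] at h₄
      revert h₄
      cases d <;> cases d' <;> simp

theorem isSAW_trail (hen : IsLatticeFrame e n) {u : List SignType}
    (hu : ∀ p s, p ++ s <:+ u → p ≠ [] → ¬ (sideways p = 0 ∧ height p = 0)) :
    IsSAW squareLattice v (trail e n v u) := by
  induction u with
  | nil => simp [IsSAW, trail, endpoint, sideways, height]
  | cons d u ih =>
    obtain ⟨h₁, h₂, h₃⟩ := ih fun p s h => hu p s (h.trans (List.suffix_cons _ _))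
    obtain ⟨l, hl⟩ := trail_eq_cons (e := e) (n := n) (v := v) u
    refine ⟨?_, ?_, ?_⟩
    · rw [trail, hl, List.getLast?_cons_cons, ← hl, h₁]
    · rw [trail, hl, List.isChain_cons_cons, ← hl]
      refine ⟨(squareLattice_adj_endpoint hen [d] u).2 ?_, h₂⟩
      cases d <;> simp [sideways, height]
    · rw [trail, List.nodup_cons]
      refine ⟨fun hmem => ?_, h₃⟩
      obtain ⟨s, ⟨p, rfl⟩, hs⟩ := exists_endpoint_of_mem_trail hmem
      exact hu (d :: p) s List.suffix_rfl (by simp)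
        ((endpoint_append_eq_iff hen (d :: p) s).1 hs)

theorem ClosesCycle.not_nodup {V : Type*} {G : SimpleGraph V} {v w x y : V} {l : List V}
    (h : ClosesCycle G v l w x y) : ¬ l.Nodup := by
  obtain ⟨q, b, rfl, -, -⟩ := h
  simp

/-- The parent of an occupied leaf is an initial segment of the walk that ends at `y`, next to an
earlier vertex `w` that was left through `x`. The words `s`, `d :: s` and `p ++ d :: s` lead to `w`,
`x` and `y`; `p ≠ []` because a closed cycle has length at least three. -/
theorem trail_mem_weitzVertices (hen : IsLatticeFrame e n) (σ : NeighborOrdering squareLattice)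
    {u : List SignType}
    (hu : ∀ p s, p ++ s <:+ u → p ≠ [] → ¬ (sideways p = 0 ∧ height p = 0))
    (hclose : ∀ p d s, p ++ d :: s <:+ u → p ≠ [] →
      |sideways (p ++ [d])| + |height (p ++ [d])| = 1 →
      ¬ σ.Precedes (endpoint e n v s) (endpoint e n v (d :: s)) (endpoint e n v (p ++ d :: s))) :
    trail e n v u ∈ weitzVertices σ v := by
  have hsaw := isSAW_trail (v := v) hen hu
  refine ⟨Or.inl hsaw, ?_, ?_⟩
  · rintro ⟨w, x, y, hc, -⟩
    exact hc.not_nodup hsaw.2.2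
  · rintro η ⟨w, x, y, ⟨q, b, rfl, -, hadj⟩, hprec⟩ hsuf
    rw [List.tail_cons] at hsuf
    obtain ⟨t, ht, heq⟩ := exists_of_suffix_trail (by simp) hsuf
    obtain ⟨s', ⟨p, rfl⟩, hs'⟩ := exists_of_suffix_trail (u := t) (l := x :: w :: b)
      (e := e) (n := n) (v := v) (by simp) (heq ▸ ⟨y :: q, by simp⟩)
    rcases s' with _ | ⟨d, s⟩
    · simpa [trail] using congrArg List.length hs'
    · obtain ⟨l, hl⟩ := trail_eq_cons (e := e) (n := n) (v := v) s
      have hx := List.cons.inj hs'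
      have hw := (List.cons.inj (hx.2.trans hl)).1
      obtain ⟨l', hl'⟩ := trail_eq_cons (e := e) (n := n) (v := v) (p ++ d :: s)
      have hy := (List.cons.inj (heq.trans hl')).1
      have hp : p ≠ [] := by
        rintro rfl
        have h₁ := congrArg List.length heq
        have h₂ := congrArg List.length hs'
        simp only [List.length_cons, List.length_append, List.nil_append] at h₁ h₂
        omega
      rw [hx.1, hw, hy] at hprec
      rw [hw, hy, List.append_cons p d s, squareLattice_adj_endpoint hen] at hadj
      exact hclose p d s ht hp hadj hprec

variable {K : List SignType → Finset SignType}

/-- The tree of the admissible words as a subtree of Weitz's tree. -/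
def weitzEmbedding (hen : IsLatticeFrame e n) (σ : NeighborOrdering squareLattice)
    (hmem : ∀ u, Admissible K u → trail e n v u ∈ weitzVertices σ v) :
    admissibleTree K ↪g weitzTree σ v where
  toFun w := ⟨trail e n v w.1, hmem w.1 w.2⟩
  inj' a b h := Subtype.ext (trail_injective hen (congrArg Subtype.val h))
  map_rel_iff' := by
    have key : ∀ (a b : List SignType), (∃ z, trail e n v b = z :: trail e n v a) ↔
        ∃ d, b = d :: a := by
      intro a b
      constructor
      · rintro ⟨z, hz⟩
        rcases b with _ | ⟨d, b⟩
        · simpa [length_trail] using congrArg List.length hz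
        · exact ⟨d, congrArg _ (trail_injective hen (List.cons.inj hz).2)⟩
      · rintro ⟨d, rfl⟩
        exact ⟨_, rfl⟩
    intro a b
    exact or_congr (key a.1 b.1) (key b.1 a.1)

theorem not_mixing_weitzTree (hen : IsLatticeFrame e n) (σ : NeighborOrdering squareLattice)
    (hmem : ∀ u, Admissible K u → trail e n v u ∈ weitzVertices σ v)
    (hK : ∀ w, (K w).Nonempty) {lam₀ : ℝ} (hlam₀ : 0 ≤ lam₀)
    (hosc : ∀ lam, lam₀ < lam → HasOscillation K lam) :
    (∀ lam : ℝ, lam₀ < lam → ¬ SSM (weitzTree σ v) lam) ∧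
      ∃ A : Set (weitzVertices σ v), ((weitzTree σ v).induce A).IsTree ∧
        ∀ lam : ℝ, lam₀ < lam → ¬ WSM ((weitzTree σ v).induce A) lam := by
  set ψ := weitzEmbedding hen σ hmem
  have hℓ : ∀ a b, (weitzTree σ v).Adj a b → b.1.length ≤ a.1.length + 1 := fun a b h => by
    have h' : (walkGraph (ℤ × ℤ)).Adj a.1 b.1 := h
    have := length_of_walkGraph_adj h'
    omega
  have hψ : ∀ w, (ψ w).1.length = (ψ ⟨[], trivial⟩).1.length + w.1.length := fun w => by
    have h : ∀ w, (ψ w).1.length = w.1.length + 1 := fun w => length_trail w.1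
    rw [h, h, List.length_nil]
    omega
  refine ⟨fun lam hlam => not_SSM_of_embedding ψ hK (hlam₀.trans_lt hlam) (hosc lam hlam)
    (ℓ := fun a => a.1.length) hℓ hψ, Set.range ψ, ?_, fun lam hlam => ?_⟩
  · exact ψ.isoInduceRange.isTree_iff.1 (isTree_admissibleTree K)
  · exact not_WSM_of_embedding ψ.isoInduceRange.toEmbedding hK (hlam₀.trans_lt hlam)
      (hosc lam hlam) ψ.isoInduceRange.surjective (ℓ := fun a => a.1.1.length)
      (fun a b h => hℓ _ _ h) hψ

end Trail

/-! ### Two turning rules that keep walks in Weitz's tree -/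

section Turns

/-- The next letter is `0`, or the letter `h w` if that is nonzero, or anything if `h w = 0`. -/
def steps (h : List SignType → SignType) (w : List SignType) : Finset SignType :=
  Finset.univ.filter fun d => d = 0 ∨ h w = 0 ∨ d = h w

/-- The last letter of the word, or `0` if there is none. -/
def lastLetter (w : List SignType) : SignType := w.headD 0

/-- The last letter of the word or, if that is `0`, the letter before it. -/
def lastTurn (w : List SignType) : SignType :=
  if lastLetter w = 0 then lastLetter w.tail else lastLetter w

variable {h : List SignType → SignType}

theorem mem_steps {w : List SignType} {d : SignType} :
    d ∈ steps h w ↔ d = 0 ∨ h w = 0 ∨ d = h w := by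
  simp [steps]

theorem steps_nonempty (w : List SignType) : (steps h w).Nonempty :=
  ⟨0, mem_steps.2 (Or.inl rfl)⟩

theorem prod_steps_of_eq_zero {w : List SignType} (hw : h w = 0) (f : SignType → ℝ) :
    ∏ d ∈ steps h w, f d = f 0 * f (-1) * f 1 := by
  have : steps h w = {0, -1, 1} := by
    ext d
    rw [mem_steps, hw]
    revert d
    decide
  rw [this, Finset.prod_insert (by decide), Finset.prod_insert (by decide), Finset.prod_singleton,
    mul_assoc]

theorem prod_steps_of_ne_zero {w : List SignType} (hw : h w ≠ 0) (f : SignType → ℝ) :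
    ∏ d ∈ steps h w, f d = f 0 * f (h w) := by
  have : steps h w = {0, h w} := by
    ext d
    rw [mem_steps, Finset.mem_insert, Finset.mem_singleton]
    tauto
  rw [this, Finset.prod_insert (by simpa using hw.symm), Finset.prod_singleton]

/-- A sideways letter can be followed only by itself or `0`, so a stretch without `0` is a run of
one letter. The clause on `lastLetter` carries the induction. -/
theorem sideways_of_height_eq_zero {p s : List SignType}
    (hp : Admissible (steps lastLetter) (p ++ s)) (hh : height p = 0) :
    p = [] ∨ (sideways p = p.length ∧ lastLetter (p ++ s) = 1) ∨
      (sideways p = -p.length ∧ lastLetter (p ++ s) = -1) := by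
  induction p with
  | nil => exact Or.inl rfl
  | cons d p ih =>
    obtain ⟨hd, hp⟩ := hp
    have hd := mem_steps.1 hd
    have h0 := height_nonneg p
    rw [height] at hh
    have hd0 : d ≠ 0 := by
      rintro rfl
      rw [if_pos rfl] at hh
      omega
    rw [if_neg hd0, add_zero] at hh
    right
    rcases ih hp hh with rfl | ⟨hs, hl⟩ | ⟨hs, hl⟩
    · cases d
      · exact absurd rfl hd0
      · exact Or.inr ⟨rfl, rfl⟩
      · exact Or.inl ⟨rfl, rfl⟩
    · simp only [List.append_eq] at hd
      rw [hl] at hd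
      obtain rfl : d = 1 := by simpa [hd0] using hd
      exact Or.inl ⟨by simp [sideways, hs], rfl⟩
    · simp only [List.append_eq] at hd
      rw [hl] at hd
      obtain rfl : d = -1 := by simpa [hd0] using hd
      exact Or.inr ⟨by simp [sideways, hs]; ring, rfl⟩

/-- With at most one `0`, the word is a run, possibly a `0`, and a run in the same direction, since
`lastTurn` remembers the direction across one `0`. Hence at height one the sideways displacement
vanishes only for `[0]`. The clauses on `lastLetter` and `lastTurn` are the memory needed by the
induction. -/
theorem displacement_lastTurn {p s : List SignType}
    (hp : Admissible (steps lastTurn) (p ++ s)) :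
    p = [] ∨ p = [0] ∨ 2 ≤ height p ∨
      (height p = 0 ∧ sideways p = p.length ∧ lastLetter (p ++ s) = 1) ∨
      (height p = 0 ∧ sideways p = -p.length ∧ lastLetter (p ++ s) = -1) ∨
      (height p = 1 ∧ 1 ≤ sideways p ∧ lastTurn (p ++ s) = 1) ∨
      (height p = 1 ∧ sideways p ≤ -1 ∧ lastTurn (p ++ s) = -1) := by
  induction p with
  | nil => exact Or.inl rfl
  | cons d p ih =>
    obtain ⟨hd, hp⟩ := hp
    have hd := mem_steps.1 hd
    simp only [List.append_eq] at hd
    have hturn : ∀ c w, lastLetter w = c → c ≠ 0 → lastTurn w = c := fun c w h hc => by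
      rw [lastTurn, h, if_neg hc]
    have hturn0 : ∀ w, lastTurn (0 :: w) = lastLetter w := fun w => rfl
    have hturn1 : ∀ w, lastTurn (1 :: w) = 1 := fun w => rfl
    have hturn2 : ∀ w, lastTurn (-1 :: w) = -1 := fun w => rfl
    have hl : ∀ w, lastLetter (d :: w) = d := fun w => rfl
    right
    simp only [List.cons_append, hl, height, sideways, List.length_cons]
    rcases ih hp with rfl | rfl | h₁ | ⟨h₁, h₂, h₃⟩ | ⟨h₁, h₂, h₃⟩ | ⟨h₁, h₂, h₃⟩ | ⟨h₁, h₂, h₃⟩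
    · rcases d.trichotomy with rfl | rfl | rfl <;> simp [height, sideways]
    · rcases d.trichotomy with rfl | rfl | rfl <;> simp [height, sideways, hturn1, hturn2]
    · right; left
      split_ifs <;> omega
    · rw [hturn _ _ h₃ (by decide)] at hd
      rcases d.trichotomy with rfl | rfl | rfl
      · exact absurd hd (by decide)
      · simp only [hturn0, h₃]
        cases p <;> simp [h₁, h₂]
      · simp [h₁, h₂]
    · rw [hturn _ _ h₃ (by decide)] at hd
      rcases d.trichotomy with rfl | rfl | rfl
      · simp [h₁, h₂]
        omega
      · simp only [hturn0, h₃]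
        cases p <;> simp [h₁, h₂]
      · exact absurd hd (by decide)
    · rw [h₃] at hd
      rcases d.trichotomy with rfl | rfl | rfl
      · exact absurd hd (by decide)
      · simp [h₁]
      · simp [h₁, hturn1]
        omega
    · rw [h₃] at hd
      rcases d.trichotomy with rfl | rfl | rfl
      · simp [h₁, hturn2]
        omega
      · simp [h₁]
      · exact absurd hd (by decide)

variable {e n : ℤ × ℤ}

theorem trail_mem_weitzVertices_of_lastLetter (hen : IsLatticeFrame e n)
    (σ : NeighborOrdering squareLattice) (v : ℤ × ℤ)
    (hσ : ∀ w, ¬ σ.Precedes w (w + e) (w + n) ∧ ¬ σ.Precedes w (w + -e) (w + n))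
    (u : List SignType) (hu : Admissible (steps lastLetter) u) :
    trail e n v u ∈ weitzVertices σ v := by
  refine trail_mem_weitzVertices hen σ (fun p s hs hp h => ?_) fun p d s hs hp h => ?_
  · have hlen := List.length_pos_iff.2 hp
    rcases sideways_of_height_eq_zero (hu.of_suffix hs) h.2 with h' | ⟨h', -⟩ | ⟨h', -⟩
    · exact hp h'
    · omega
    · omega
  · have hlen := List.length_pos_iff.2 hp
    have hs' := hu.of_suffix hs
    have h0 := height_nonneg (p ++ [d])
    rw [abs_of_nonneg h0] at h
    have hx := abs_nonneg (sideways (p ++ [d]))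
    -- At height `0` the stretch would be a straight run of at least two steps, ending too far away
    -- to close a cycle.
    have h1 : height (p ++ [d]) = 1 := by
      by_contra hne
      have hz : height (p ++ [d]) = 0 := by omega
      have hs'' : Admissible (steps lastLetter) ((p ++ [d]) ++ s) := by simpa using hs'
      rcases sideways_of_height_eq_zero hs'' hz with h' | ⟨h', -⟩ | ⟨h', -⟩
      · simp at h'
      · rw [h', hz, List.length_append, List.length_singleton, abs_of_nonneg (by positivity)] at h
        omega
      · rw [h', hz, List.length_append, List.length_singleton, abs_neg,
          abs_of_nonneg (by positivity)] at h
        omega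
    have h2 : sideways (p ++ [d]) = 0 := abs_eq_zero.1 (by omega)
    -- If the first step were `n`, the walk would already be at `w + n` and would have to return
    -- there without a further step `n`.
    have hd : d ≠ 0 := by
      rintro rfl
      rw [height_append] at h1
      rw [sideways_append] at h2
      simp only [height, sideways, SignType.coe_zero, if_true] at h1 h2
      rcases sideways_of_height_eq_zero hs' (by omega) with h' | ⟨h', -⟩ | ⟨h', -⟩
      · exact hp h'
      · omega
      · omega
    have hend : endpoint e n v (p ++ d :: s) = endpoint e n v s + n := by
      rw [List.append_cons, endpoint_append, h1, h2]
      simp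
    have hstep : endpoint e n v (d :: s) = endpoint e n v s + (d : ℤ) • e := by
      rw [← List.singleton_append, endpoint_append]
      simp [sideways, height, hd]
    rw [hend, hstep]
    rcases d.trichotomy with rfl | rfl | rfl
    · simpa using (hσ (endpoint e n v s)).2
    · exact absurd rfl hd
    · simpa using (hσ (endpoint e n v s)).1

/-- By `displacement_lastTurn`, at least two steps always produce a displacement of `ℓ¹` norm at
least `2`, so no cycle can be closed, whatever `σ` is. -/
theorem trail_mem_weitzVertices_of_lastTurn (hen : IsLatticeFrame e n)
    (σ : NeighborOrdering squareLattice) (v : ℤ × ℤ)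
    (u : List SignType) (hu : Admissible (steps lastTurn) u) :
    trail e n v u ∈ weitzVertices σ v := by
  refine trail_mem_weitzVertices hen σ (fun p s hs hp h => ?_) fun p d s hs hp h => ?_
  · have hlen := List.length_pos_iff.2 hp
    rcases displacement_lastTurn (hu.of_suffix hs) with h' | rfl | h' | ⟨-, h', -⟩ | ⟨-, h', -⟩ |
      ⟨h', -⟩ | ⟨h', -⟩
    · exact hp h'
    · simp [height] at h
    all_goals omega
  · exfalso
    have hlen := List.length_pos_iff.2 hp
    have hl : (p ++ [d]).length = p.length + 1 := by simp
    have hs' : Admissible (steps lastTurn) ((p ++ [d]) ++ s) := by simpa using hu.of_suffix hs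
    rw [abs_of_nonneg (height_nonneg _)] at h
    rcases displacement_lastTurn hs' with h' | h' | h' | ⟨-, h', -⟩ | ⟨-, h', -⟩ |
      ⟨h₁, h', -⟩ | ⟨h₁, h', -⟩
    · simp at h'
    · rw [h', List.length_singleton] at hl
      omega
    all_goals
      have h0 := height_nonneg (p ++ [d])
      rcases abs_cases (sideways (p ++ [d])) with ha | ha <;> omega

end Turns

/-! ### Period-two bounds for the two recursions -/

section Oscillation

theorem hasOscillation_lastLetter {lam : ℝ} (hlam : 3 < lam) :
    HasOscillation (steps lastLetter) lam := by
  -- The values `b`, `d` after a turn, with `b / (1 + d)`, `d / (1 + b)` after a `0`, form an exact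
  -- period-two orbit: `bd = 1` gives `d * (1 + b) = 1 + d`, and each equation reduces to `1 + b + d
  -- = lam`. The roots of `t² - (lam - 1) t + 1` are real and distinct exactly because `lam - 1 >
  -- 2`.
  obtain ⟨b, d, hb, hbd, hmul, hadd⟩ : ∃ b d : ℝ, 0 < b ∧ b < d ∧ b * d = 1 ∧ b + d = lam - 1 := by
    have hD : 0 < (lam - 1) ^ 2 - 4 := by nlinarith
    have hsq := Real.sq_sqrt hD.le
    have hs := Real.sqrt_pos.2 hD
    set s := Real.sqrt ((lam - 1) ^ 2 - 4)
    exact ⟨(lam - 1 - s) / 2, (lam - 1 + s) / 2, by nlinarith, by linarith, by nlinarith, by ring⟩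
  have hd : 0 < d := hb.trans hbd
  have hval : ∀ (a c : ℝ) (s : SignType) (w : List SignType),
      (fun w => if lastLetter w = 0 then a else c) (s :: w) = if s = 0 then a else c :=
    fun a c s w => rfl
  refine ⟨fun w => if lastLetter w = 0 then b / (1 + d) else b,
    fun w => if lastLetter w = 0 then d / (1 + b) else d, fun w => ?_, fun w => ?_, fun w => ?_,
    fun w => ?_, ?_⟩
  · dsimp only; split_ifs <;> positivity
  · dsimp only; split_ifs <;> positivity
  · simp only [hval]
    by_cases hw : lastLetter w = 0
    · rw [prod_steps_of_eq_zero hw]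
      simp [hw]
      field_simp
      nlinarith
    · rw [prod_steps_of_ne_zero hw]
      simp [hw]
      field_simp
      nlinarith
  · simp only [hval]
    by_cases hw : lastLetter w = 0
    · rw [prod_steps_of_eq_zero hw]
      simp [hw]
      field_simp
      nlinarith
    · rw [prod_steps_of_ne_zero hw]
      simp [hw]
      field_simp
      nlinarith
  · simp [lastLetter]
    gcongr

/-- The function on words with the value `a` if neither of the last two letters is a turn, `b` if
the last letter is a turn, and `c` if only the letter before it is. -/
noncomputable def turnValue (a b c : ℝ) (w : List SignType) : ℝ :=
  if lastLetter w = 0 then if lastLetter w.tail = 0 then a else c else b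

theorem turnValue_nonneg {a b c : ℝ} (ha : 0 ≤ a) (hb : 0 ≤ b) (hc : 0 ≤ c) (w : List SignType) :
    0 ≤ turnValue a b c w := by
  unfold turnValue
  split_ifs <;> assumption

/-- The three types form a closed system: the children of type `a` have types `a, b, b`, those of
`b` have `c, b`, those of `c` have `a, b`. One step of the recursion becomes three scalar
inequalities. -/
theorem turnValue_mul_prod (a b c a' b' c' : ℝ) (w : List SignType) :
    turnValue a b c w * ∏ d ∈ steps lastTurn w, (1 + turnValue a' b' c' (d :: w)) =
      turnValue (a * ((1 + a') * (1 + b') * (1 + b'))) (b * ((1 + c') * (1 + b')))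
        (c * ((1 + a') * (1 + b'))) w := by
  have h0 : turnValue a' b' c' (0 :: w) = if lastLetter w = 0 then a' else c' := rfl
  have h1 : ∀ d ≠ 0, turnValue a' b' c' (d :: w) = b' := fun d hd => if_neg hd
  by_cases hw : lastTurn w = 0
  · rw [prod_steps_of_eq_zero hw, h0, h1 _ (by decide), h1 _ (by decide)]
    have hl : lastLetter w = 0 := by
      by_contra h
      rw [lastTurn, if_neg h] at hw
      exact h hw
    have ht : lastLetter w.tail = 0 := by rwa [lastTurn, if_pos hl] at hw
    simp only [turnValue, hl, ht, if_true]
  · rw [prod_steps_of_ne_zero hw, h0, h1 _ hw]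
    by_cases hl : lastLetter w = 0
    · have ht : lastLetter w.tail ≠ 0 := by rwa [lastTurn, if_pos hl] at hw
      simp only [turnValue, hl, ht, if_true, if_false]
    · simp only [turnValue, hl, if_false]

theorem turnValue_le {a b c l : ℝ} (ha : a ≤ l) (hb : b ≤ l) (hc : c ≤ l) (w : List SignType) :
    turnValue a b c w ≤ l := by
  unfold turnValue
  split_ifs <;> assumption

theorem le_turnValue {a b c l : ℝ} (ha : l ≤ a) (hb : l ≤ b) (hc : l ≤ c) (w : List SignType) :
    l ≤ turnValue a b c w := by
  unfold turnValue
  split_ifs <;> assumption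

theorem hasOscillation_lastTurn {lam : ℝ} (hlam : 3.4 < lam) :
    HasOscillation (steps lastTurn) lam := by
  obtain ⟨u, hu, rfl⟩ : ∃ u : ℝ, 0 ≤ u ∧ 3.4 * (1 + u) = lam :=
    ⟨lam / 3.4 - 1, by rw [sub_nonneg, le_div_iff₀] <;> linarith, by ring⟩
  -- At `u = 0` the six numbers are approximately a period-two orbit for `lam = 3.4`, rounded so
  -- that every inequality has the right sign; all the products are within `0.0005` of `3.4`. For `u
  -- > 0` most upper values scale with `lam`. The third lower inequality needs the faster growth
  -- `1.1` in the first upper value, and the first lower value is shrunk to make room for it.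
  refine ⟨turnValue (0.4474 / (1 + 0.46 * u)) 0.697 0.9154,
    turnValue (0.8156 * (1 + 1.1 * u)) (1.046 * (1 + u)) (1.3842 * (1 + u)),
    turnValue_nonneg (by positivity) (by norm_num) (by norm_num),
    turnValue_nonneg (by positivity) (by positivity) (by positivity), fun w => ?_, fun w => ?_, ?_⟩
  · rw [turnValue_mul_prod]
    apply turnValue_le
    · rw [show (1 : ℝ) + 0.4474 / (1 + 0.46 * u) = (1.4474 + 0.46 * u) / (1 + 0.46 * u) by
        field_simp; ring, div_mul_eq_mul_div, div_mul_eq_mul_div, mul_div_assoc',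
        div_le_iff₀ (by positivity)]
      nlinarith [mul_nonneg hu hu]
    · nlinarith
    · have : 0.4474 / (1 + 0.46 * u) ≤ 0.4474 := div_le_self (by norm_num) (by linarith)
      nlinarith
  · rw [turnValue_mul_prod]
    have h2 := mul_nonneg hu hu
    have h3 := mul_nonneg h2 hu
    apply le_turnValue
    · rw [div_mul_eq_mul_div, le_div_iff₀ (by positivity)]
      ring_nf
      nlinarith
    · nlinarith
    · nlinarith
  · change 0.4474 / (1 + 0.46 * u) < 0.8156 * (1 + 1.1 * u)
    rw [div_lt_iff₀ (by positivity)]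
    nlinarith [mul_nonneg hu hu]

end Oscillation

/-! ### Choice of the forward direction -/

section Directions

theorem isLatticeFrame_of_abs_add_abs_eq_one {m : ℤ × ℤ} (hm : |m.1| + |m.2| = 1) :
    IsLatticeFrame (-m.2, m.1) m := by
  obtain ⟨x, y⟩ := m
  have hx := abs_nonneg x
  have hy := abs_nonneg y
  have h : (x = 0 ∧ |y| = 1) ∨ (|x| = 1 ∧ y = 0) := by
    by_cases h : x = 0
    · subst h
      exact Or.inl ⟨rfl, by simpa using hm⟩
    · have := abs_pos.2 h
      exact Or.inr ⟨by simp only at hm; omega, abs_eq_zero.1 (by simp only at hm; omega)⟩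
  intro a b
  rcases h with ⟨rfl, h⟩ | ⟨h, rfl⟩
  · simp [abs_mul, h]
  · simp [abs_mul, h, add_comm]

/-- Take `n` to be the least neighbor of the origin; homogeneity makes this direction least at every
vertex. The vector `e` is a quarter turn of `n`. -/
theorem NeighborOrdering.IsHomogeneous.exists_frame {σ : NeighborOrdering squareLattice}
    (hσ : σ.IsHomogeneous) : ∃ e n : ℤ × ℤ, IsLatticeFrame e n ∧
      ∀ w, ¬ σ.Precedes w (w + e) (w + n) ∧ ¬ σ.Precedes w (w + -e) (w + n) := by
  have hfin : (squareLattice.neighborSet 0).Finite := by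
    refine (Set.toFinite (Set.Icc (-1 : ℤ) 1 ×ˢ Set.Icc (-1 : ℤ) 1)).subset fun p hp => ?_
    have hp' : |(0 : ℤ) - p.1| + |(0 : ℤ) - p.2| = 1 := hp
    rw [zero_sub, zero_sub, abs_neg, abs_neg] at hp'
    have h₁ := abs_nonneg p.1
    have h₂ := abs_nonneg p.2
    exact ⟨abs_le.1 (by omega), abs_le.1 (by omega)⟩
  have : Finite (squareLattice.neighborSet 0) := hfin
  have : Nonempty (squareLattice.neighborSet 0) := ⟨⟨(1, 0), by simp [squareLattice]⟩⟩
  obtain ⟨⟨m, hm⟩, hmin⟩ := @Finite.exists_min _ _ _ _ (σ 0) id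
  have hm' : |m.1| + |m.2| = 1 := by simpa [squareLattice] using hm
  have key : ∀ w e : ℤ × ℤ, ¬ σ.Precedes w (w + e) (w + m) := by
    intro w e h
    obtain ⟨hx, hy, hlt⟩ := (hσ w 0 e m).1 h
    have hle := hmin ⟨0 + e, hx⟩
    have hm₀ : (⟨0 + m, hy⟩ : squareLattice.neighborSet 0) = ⟨m, hm⟩ :=
      Subtype.ext (zero_add m)
    rw [hm₀] at hlt
    exact @not_lt_of_ge _ (σ 0).toPreorder _ _ hle hlt
  exact ⟨_, m, isLatticeFrame_of_abs_add_abs_eq_one hm', fun w => ⟨key w _, key w _⟩⟩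

end Directions

theorem theorem1 (σ : NeighborOrdering squareLattice) (v : ℤ × ℤ) :
    ((∀ lam : ℝ, 3.4 < lam → ¬ SSM (weitzTree σ v) lam) ∧
      ∃ A : Set (weitzVertices σ v), ((weitzTree σ v).induce A).IsTree ∧
        ∀ lam : ℝ, 3.4 < lam → ¬ WSM ((weitzTree σ v).induce A) lam) ∧
    (σ.IsHomogeneous →
      (∀ lam : ℝ, 3 < lam → ¬ SSM (weitzTree σ v) lam) ∧
      ∃ A : Set (weitzVertices σ v), ((weitzTree σ v).induce A).IsTree ∧
        ∀ lam : ℝ, 3 < lam → ¬ WSM ((weitzTree σ v).induce A) lam) := by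
  constructor
  · have hen : IsLatticeFrame (-0, 1) (1, 0) :=
      isLatticeFrame_of_abs_add_abs_eq_one (m := (1, 0)) (by simp)
    exact not_mixing_weitzTree hen σ (trail_mem_weitzVertices_of_lastTurn hen σ v)
      steps_nonempty (by norm_num) fun lam => hasOscillation_lastTurn
  · intro hσ
    obtain ⟨e, n, hen, hn⟩ := hσ.exists_frame
    exact not_mixing_weitzTree hen σ (trail_mem_weitzVertices_of_lastLetter hen σ v hn)
      steps_nonempty (by norm_num) fun lam => hasOscillation_lastLetter
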